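/- **Setting.** Let $V=(V_1,\dots,V_d)^\top$ be a random vector with nonnegative components and Pareto tails: for some $\alpha>0$ and $K_1,\dots,K_d>0$, $\mathbb P(V_j>t)\sim K_jt^{-\alpha}$ as $t\to\infty$ (where $f\sim g$ means $f/g\to1$). Fix a norm $\|\cdot\|$ on $\mathbb R^d$ with $\|e_j\|=1$ for all unit vectors $e_j$, and let $\mathcal E=[0,\infty]^d\setminus\{0\}$, whose relatively compact subsets are those bounded away from $0$. Assume that $V$ is multivariate regularly varying with intensity measure $\mu$: $\mu$ is a nonzero Radon measure on $\mathcal E$ with $\mu(\mathcal E\setminus[0,\infty)^d)=0$, and $$\frac{\mathbb P(V\in t\,\cdot)}{\mathbb P(\|V\|>t)}\xrightarrow{\ v\ }\mu(\cdot)\quad(t\to\infty)$$ vaguely on $\mathcal E$. We say that $V_1,\dots,V_d$ are *asymptotically independent* if $\mu$ is concentrated on the coordinate axes, and *asymptotically fully dependent* if $\mu$ is concentrated on the half-line $\{sK^{1/\alpha}\mathbf 1: s>0\}$, where $K^{1/\alpha}=\mathrm{diag}(K_1^{1/\alpha},\dots,K_d^{1/\alpha})$ and $\mathbf 1=(1,\dots,1)^\top\in\mathbb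 R^d$. Let $W$ be a random $q\times d$ matrix with nonnegative entries such that $\mathbb E\|W\|^{\alpha+\delta}<\infty$ for some $\delta>0$ and some norm on $\mathbb R^{q\times d}$. Let $\sim$ be the edge relation of a random bipartite graph between agents $1,\dots,q$ and objects $1,\dots,d$, put $A_{ij}=W_{ij}\mathbf 1(i\sim j)$, assume that the random matrix $A$ is independent of $V$, and let $F=AV$. Let $h:\mathbb R_+^q\to\mathbb R_+$ be continuous with $h(cx)=c\,h(x)$ for all $c>0$ and $x\in\mathbb R_+^q$. **Proposition.** Set $$C^h=C^h_{\mathrm{ind}}=\sum_{j=1}^dK_j\,\mathbb E\,h^\alpha(Ae_j)\qquad\text{or}\qquad C^h=C^h_{\mathrm{dep}}=\mathbb E\,h^\alpha(AK^{1/\alpha}\mathbf 1)$$ if $V_1,\dots,V_d$ are asymptotically independent or asymptotically fully dependent, respectively. In either case the expectations in $C^h$ are finite and $$\lim_{t\to\infty}t^{\alpha}\,\mathbb P(h(F)>t)=C^h .$$ Consequently $\mathbb P(h(F)>t)\sim C^h\,t^{-\alpha}$ as $t\to\infty$ whenever $C^h\neq0$. Moreover $C^h>0$ if $h(x)\neq0$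 for all $x\in\mathbb R_+^q\setminus\{0\}$ and $\mathbb P(A\neq0)>0$. -/

import Mathlib

open MeasureTheory ProbabilityTheory Filter Topology Asymptotics
open scoped ENNReal Matrix

noncomputable section

namespace BipartiteRisk

/-- The punctured compactified orthant `[0, ∞]^d \ {0}`, with the subspace topology of the product
topology. Its relatively compact sets are exactly the sets bounded away from the origin. -/
abbrev PuncturedOrthant (d : ℕ) : Type := {x : Fin d → ℝ≥0∞ // x ≠ 0}

/-- The measure `B ↦ ℙ(X ∈ t B) / ℙ(N X > t)` on `[0, ∞]^d \ {0}`, for a random vector `X` with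
nonnegative components and a norm `N`. -/
def rescaledTail {Ω : Type*} [MeasurableSpace Ω] (P : Measure Ω) {d : ℕ}
    (N : Seminorm ℝ (Fin d → ℝ)) (X : Ω → Fin d → ℝ) (t : ℝ) : Measure (PuncturedOrthant d) :=
  (P {ω | t < N (X ω)})⁻¹ •
    (P.map (fun ω i => ENNReal.ofReal (X ω i / t))).comap
      (Subtype.val : PuncturedOrthant d → (Fin d → ℝ≥0∞))

/-- `X` is multivariate regularly varying with intensity measure `μ` (normalised by the norm `N`):
`μ` is a nonzero Radon measure on `[0, ∞]^d \ {0}` without mass on the points having an infinite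
coordinate, and the measures `ℙ(X ∈ t ·) / ℙ(N X > t)` converge vaguely to `μ` as `t → ∞`.
(On this locally compact, second countable, metrizable space a Borel measure that is finite on
compact sets is Radon.) -/
structure IsIntensityMeasure {Ω : Type*} [MeasurableSpace Ω] (P : Measure Ω) {d : ℕ}
    (N : Seminorm ℝ (Fin d → ℝ)) (X : Ω → Fin d → ℝ) (μ : Measure (PuncturedOrthant d)) :
    Prop where
  finite_on_compacts : IsFiniteMeasureOnCompacts μ
  ne_zero : μ ≠ 0
  no_mass_at_infinity : μ {x | ∃ i, x.1 i = ∞} = 0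
  vague : ∀ f : PuncturedOrthant d → ℝ, Continuous f → HasCompactSupport f →
    Tendsto (fun t : ℝ => ∫ x, f x ∂(rescaledTail P N X t)) atTop (𝓝 (∫ x, f x ∂μ))

/-- Asymptotic independence of the components: the intensity measure is concentrated on the
coordinate axes, i.e. it does not charge the points with two nonzero coordinates. -/
def AsympIndependent {d : ℕ} (μ : Measure (PuncturedOrthant d)) : Prop :=
  μ {x | ∃ i j, i ≠ j ∧ x.1 i ≠ 0 ∧ x.1 j ≠ 0} = 0

/-- Asymptotic full dependence of the components, with tail constants `K` and tail index `α`: the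
intensity measure is concentrated on the half-line `{s • (K₁^(1/α), …, K_d^(1/α)) : s > 0}`. -/
def AsympFullyDependent {d : ℕ} (μ : Measure (PuncturedOrthant d)) (K : Fin d → ℝ) (α : ℝ) :
    Prop :=
  μ {x | ∃ s : ℝ, 0 < s ∧ ∀ j, x.1 j = ENNReal.ofReal (s * K j ^ (1 / α))}ᶜ = 0

open Classical in
/-- The random weighted adjacency matrix `A i j = W i j * 𝟙(i ∼ j)` of the bipartite graph with
edge relation `E` between agents `i` and objects `j`. -/
def weightedAdj {Ω : Type*} {q d : ℕ} (W : Ω → Matrix (Fin q) (Fin d) ℝ)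
    (E : Ω → Fin q → Fin d → Prop) (ω : Ω) : Matrix (Fin q) (Fin d) ℝ :=
  Matrix.of fun i j => if E ω i j then W ω i j else 0

/-- A continuous 1-homogeneous aggregation function `ℝ₊^q → ℝ₊` (values of `h` outside the
nonnegative orthant are irrelevant). -/
structure IsAggregation {q : ℕ} (h : (Fin q → ℝ) → ℝ) : Prop where
  nonneg : ∀ x, 0 ≤ x → 0 ≤ h x
  continuousOn : ContinuousOn h {x | 0 ≤ x}
  homogeneous : ∀ (c : ℝ) (x : Fin q → ℝ), 0 < c → 0 ≤ x → h (c • x) = c * h x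

/-- `C^h_ind = ∑ j, K j * 𝔼 h(A e_j)^α`. -/
def constInd {Ω : Type*} [MeasurableSpace Ω] (P : Measure Ω) {q d : ℕ}
    (A : Ω → Matrix (Fin q) (Fin d) ℝ) (K : Fin d → ℝ) (α : ℝ) (h : (Fin q → ℝ) → ℝ) : ℝ :=
  ∑ j, K j * ∫ ω, h (A ω *ᵥ Pi.single j 1) ^ α ∂P

/-- `C^h_dep = 𝔼 h(A K^(1/α) 1)^α`, where `K^(1/α)` is the diagonal matrix of the `K j ^ (1/α)` and
`1` is the all-ones vector. -/
def constDep {Ω : Type*} [MeasurableSpace Ω] (P : Measure Ω) {q d : ℕ}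
    (A : Ω → Matrix (Fin q) (Fin d) ℝ) (K : Fin d → ℝ) (α : ℝ) (h : (Fin q → ℝ) → ℝ) : ℝ :=
  ∫ ω, h ((A ω * Matrix.diagonal (fun j => K j ^ (1 / α))) *ᵥ (1 : Fin d → ℝ)) ^ α ∂P

/-- The tail asymptotics `ℙ(Y > t) ∼ C t^(-α)` as `t → ∞`: always `ℙ(Y > t) / t^(-α) → C`, and, in
the nondegenerate case `C ≠ 0`, the quotient of the two sides of `∼` tends to `1`. -/
def HasTail {Ω : Type*} [MeasurableSpace Ω] (P : Measure Ω) (Y : Ω → ℝ) (C α : ℝ) : Prop :=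
  Tendsto (fun t : ℝ => P.real {ω | t < Y ω} / t ^ (-α)) atTop (𝓝 C) ∧
    (C ≠ 0 → (fun t : ℝ => P.real {ω | t < Y ω}) ~[atTop] fun t : ℝ => C * t ^ (-α))

end BipartiteRisk

end

/-! Freeze the matrix first. For a fixed matrix `a`, the map `g x = h (a x)` is continuous and
homogeneous, and it is compared with a simpler homogeneous `k` whose tail follows from the Pareto
margins: `k x = max_j g(e_j) x_j` under asymptotic independence, and `k x = (g w / w_i) x_i` with
`w_j = K_j ^ (1/α)` and one coordinate `i` under full dependence. Both agree with `g` on the set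
that carries `μ`, so `|g - k|` vanishes `μ`-almost everywhere.

A homogeneous `f` vanishing on the carrier of `μ` satisfies `P(f(V) > η t) = o(t ^ (-α))`
(`tendsto_tail_of_ae_zero`): vague convergence is tested against `max (f - η/2) 0`, whose integral
under `μ` is zero. Only this null limit is needed, so `μ` is never computed; the normalising
probability enters through the crude bound `P(N V > t) = O(t ^ (-α))`. Since test functions live on
the compactified orthant, `f` is precomposed with a truncation, and the event that `V` exceeds the
truncation level is made small by the Pareto tails. A negligible difference does not change a tail
constant (`tendsto_tail_of_negligible_diff`), so `g(V)` inherits the tail of `k(V)`. For the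
maximum, that tail comes from the union bound and a Bonferroni bound, the joint exceedances being
negligible by the same principle.

The random matrix is then restored by Fubini and dominated convergence
(`tendsto_tail_mulVec_of_indepFun`): the frozen tails, multiplied by `t ^ α`, are bounded by a
multiple of `‖A‖ ^ α`, which is integrable. -/

namespace BipartiteRisk

/-! ### Comparison of homogeneous functions with the norm -/

section NormComparison

/-- A definite seminorm on a finite-dimensional space dominates a multiple of the norm. -/
theorem exists_pos_mul_norm_le {E : Type*} [NormedAddCommGroup E] [NormedSpace ℝ E]
    [FiniteDimensional ℝ E] (p : Seminorm ℝ E) (hp : ∀ x, p x = 0 → x = 0) :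
    ∃ c > 0, ∀ x, c * ‖x‖ ≤ p x := by
  -- A finite convex function on a finite-dimensional space is continuous, so the seminorm attains
  -- its minimum on the unit sphere.
  have hcont : Continuous p := by
    simpa using p.convexOn.continuousOn_interior
  have : ProperSpace E := FiniteDimensional.proper ℝ E
  rcases (Metric.sphere (0 : E) 1).eq_empty_or_nonempty with he | hne
  · refine ⟨1, one_pos, fun x => ?_⟩
    by_cases hx : x = 0
    · simp [hx]
    · have : (‖x‖⁻¹ • x) ∈ Metric.sphere (0 : E) 1 := by
        simp [norm_smul, hx]
      simp [he] at this
  · obtain ⟨y, hy, hmin⟩ := (isCompact_sphere (0 : E) 1).exists_isMinOn hne hcont.continuousOn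
    have hy0 : y ≠ 0 := by
      rintro rfl
      simp at hy
    refine ⟨p y, lt_of_le_of_ne (apply_nonneg p y) (fun h => hy0 (hp y h.symm)), fun x => ?_⟩
    by_cases hx : x = 0
    · simp [hx]
    · have hx' : 0 < ‖x‖ := norm_pos_iff.2 hx
      have hmem : (‖x‖⁻¹ • x) ∈ Metric.sphere (0 : E) 1 := by
        simp [norm_smul, hx]
      have := isMinOn_iff.1 hmin _ hmem
      rw [map_smul_eq_mul, norm_inv, norm_norm] at this
      rw [← le_div_iff₀ hx', div_eq_inv_mul]
      exact this

/-- A continuous positively homogeneous function on a finite-dimensional space is bounded by a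
multiple of the norm. -/
theorem exists_abs_le_mul_norm {E : Type*} [NormedAddCommGroup E] [NormedSpace ℝ E]
    [FiniteDimensional ℝ E] {f : E → ℝ} (hf : Continuous f)
    (hom : ∀ (c : ℝ) x, 0 < c → f (c • x) = c * f x) :
    ∃ H, 0 ≤ H ∧ ∀ x, |f x| ≤ H * ‖x‖ := by
  have : ProperSpace E := FiniteDimensional.proper ℝ E
  obtain ⟨H, hH⟩ := (isCompact_sphere (0 : E) 1).exists_bound_of_continuousOn hf.continuousOn
  refine ⟨max H 0, le_max_right _ _, fun x => ?_⟩
  by_cases hx : x = 0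
  · have h0 : f 0 = 0 := by
      have := hom 2 0 two_pos
      rw [smul_zero] at this
      linarith
    simp [hx, h0]
  · have hx' : 0 < ‖x‖ := norm_pos_iff.2 hx
    have hmem : (‖x‖⁻¹ • x) ∈ Metric.sphere (0 : E) 1 := by
      simp [norm_smul, hx]
    have := hH _ hmem
    rw [hom _ _ (inv_pos.2 hx'), Real.norm_eq_abs, abs_mul, abs_inv, abs_norm,
      ← div_eq_inv_mul, div_le_iff₀ hx'] at this
    exact this.trans (mul_le_mul_of_nonneg_right (le_max_left _ _) hx'.le)

theorem map_zero_of_homogeneous {E : Type*} [AddCommGroup E] [Module ℝ E] {f : E → ℝ}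
    (hom : ∀ (c : ℝ) x, 0 < c → f (c • x) = c * f x) : f 0 = 0 := by
  have := hom 2 0 two_pos
  rw [smul_zero] at this
  linarith

theorem norm_mulVec_le_card_mul {m n : Type*} [Fintype m] [Fintype n] (a : m → n → ℝ) (v : n → ℝ) :
    ‖Matrix.of a *ᵥ v‖ ≤ Fintype.card n * ‖a‖ * ‖v‖ := by
  rw [pi_norm_le_iff_of_nonneg (by positivity)]
  intro i
  calc ‖(Matrix.of a *ᵥ v) i‖ = ‖∑ j, a i j * v j‖ := rfl
    _ ≤ ∑ j, ‖a i j * v j‖ := norm_sum_le _ _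
    _ ≤ ∑ _j : n, ‖a‖ * ‖v‖ := by
        refine Finset.sum_le_sum fun j _ => ?_
        rw [norm_mul]
        gcongr
        · exact (norm_le_pi_norm (a i) j).trans (norm_le_pi_norm a i)
        · exact norm_le_pi_norm v j
    _ = Fintype.card n * ‖a‖ * ‖v‖ := by simp [mul_assoc]

end NormComparison

/-! ### Calculus of power tails -/

section Tails

variable {Ω : Type*} [MeasurableSpace Ω] {P : Measure Ω} {α : ℝ}

theorem tendsto_rpow_mul_tail_of_isEquivalent {Y : Ω → ℝ} {C : ℝ}
    (hY : (fun t : ℝ => P.real {ω | t < Y ω}) ~[atTop] fun t : ℝ => C * t ^ (-α)) :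
    Tendsto (fun t : ℝ => t ^ α * P.real {ω | t < Y ω}) atTop (𝓝 C) := by
  have h1 : (fun t : ℝ => t ^ α * P.real {ω | t < Y ω}) ~[atTop]
      fun t : ℝ => t ^ α * (C * t ^ (-α)) := (IsEquivalent.refl).mul hY
  have h2 : (fun t : ℝ => t ^ α * (C * t ^ (-α))) =ᶠ[atTop] fun _ => C := by
    filter_upwards [eventually_gt_atTop 0] with t ht
    rw [mul_left_comm, ← Real.rpow_add ht, add_neg_cancel, Real.rpow_zero, mul_one]
  exact (h1.trans h2.isEquivalent).tendsto_const

theorem hasTail_of_tendsto {Y : Ω → ℝ} {C : ℝ}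
    (hY : Tendsto (fun t : ℝ => t ^ α * P.real {ω | t < Y ω}) atTop (𝓝 C)) :
    HasTail P Y C α := by
  have h1 : Tendsto (fun t : ℝ => P.real {ω | t < Y ω} / t ^ (-α)) atTop (𝓝 C) := by
    refine hY.congr' ?_
    filter_upwards [eventually_gt_atTop 0] with t ht
    rw [Real.rpow_neg ht.le, div_inv_eq_mul, mul_comm]
  refine ⟨h1, fun hC => isEquivalent_of_tendsto_one ?_⟩
  have h2 := h1.div_const C
  rw [div_self hC] at h2
  refine h2.congr fun t => ?_
  simp only [Pi.div_apply]
  rw [div_div, mul_comm]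

theorem tendsto_tail_const_mul (hα : 0 < α) {Y : Ω → ℝ} {C c : ℝ} (hc : 0 ≤ c)
    (hY : Tendsto (fun t : ℝ => t ^ α * P.real {ω | t < Y ω}) atTop (𝓝 C)) :
    Tendsto (fun t : ℝ => t ^ α * P.real {ω | t < c * Y ω}) atTop (𝓝 (C * c ^ α)) := by
  rcases hc.eq_or_lt with rfl | hc
  · rw [Real.zero_rpow hα.ne', mul_zero]
    refine tendsto_const_nhds.congr' ?_
    filter_upwards [eventually_gt_atTop 0] with t ht
    simp [ht.not_gt]
  · have h1 := (hY.comp (tendsto_id.atTop_div_const hc)).mul_const (c ^ α)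
    refine h1.congr' ?_
    filter_upwards [eventually_gt_atTop 0] with t ht
    simp only [Function.comp, id, div_lt_iff₀ hc, Real.div_rpow ht.le hc.le]
    have : c ^ α ≠ 0 := (Real.rpow_pos_of_pos hc _).ne'
    field_simp
    simp only [mul_comm]

/-- Tail asymptotics are stable under perturbations of negligible tail. -/
theorem tendsto_tail_of_negligible_diff [IsFiniteMeasure P] (hα : 0 < α) {Y Z : Ω → ℝ} {C : ℝ}
    (hZ : Tendsto (fun t : ℝ => t ^ α * P.real {ω | t < Z ω}) atTop (𝓝 C))
    (hYZ : ∀ η > 0,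
      Tendsto (fun t : ℝ => t ^ α * P.real {ω | η * t < |Y ω - Z ω|}) atTop (𝓝 0)) :
    Tendsto (fun t : ℝ => t ^ α * P.real {ω | t < Y ω}) atTop (𝓝 C) := by
  have hcont : Tendsto (fun c : ℝ => C * c ^ α) (𝓝 1) (𝓝 C) := by
    have : ContinuousAt (fun c : ℝ => C * c ^ α) 1 :=
      continuousAt_const.mul (Real.continuousAt_rpow_const _ _ (Or.inl one_ne_zero))
    simpa [ContinuousAt] using this
  refine tendsto_order.2 ⟨fun b hb => ?_, fun b hb => ?_⟩
  -- If `Z > t / c` and `|Y - Z| ≤ (1/c - 1) t`, then `Y > t`. Taking `c` close to 1 costs only the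
  -- factor `c ^ α` in the limit; the upper bound is symmetric with `c > 1`.
  · have h1 : ∀ᶠ c in 𝓝[<] (1 : ℝ), b < C * c ^ α :=
      (hcont.mono_left nhdsWithin_le_nhds).eventually (lt_mem_nhds hb)
    obtain ⟨c, hbc, hc0, hc1⟩ :=
      (h1.and (Ioo_mem_nhdsLT (zero_lt_one' ℝ))).exists
    have hη : 0 < c⁻¹ - 1 := sub_pos.2 ((one_lt_inv₀ hc0).2 hc1)
    have h2 := (tendsto_tail_const_mul hα hc0.le hZ).sub (hYZ _ hη)
    rw [sub_zero] at h2
    filter_upwards [h2.eventually (lt_mem_nhds hbc), eventually_gt_atTop 0] with t ht ht0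
    refine ht.trans_le ?_
    rw [← mul_sub]
    refine mul_le_mul_of_nonneg_left ?_ (Real.rpow_nonneg ht0.le _)
    rw [sub_le_iff_le_add]
    refine (measureReal_mono ?_).trans (measureReal_union_le _ _)
    intro ω hω
    by_contra hcon
    simp only [Set.mem_union, Set.mem_ofPred_eq, not_or, not_lt] at hcon hω
    have h3 := (abs_le.1 hcon.2).1
    have h4 : c⁻¹ * t < Z ω := by
      rw [inv_mul_lt_iff₀ hc0]; exact hω
    linarith [hcon.1]
  · have h1 : ∀ᶠ c in 𝓝[>] (1 : ℝ), C * c ^ α < b :=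
      (hcont.mono_left nhdsWithin_le_nhds).eventually (gt_mem_nhds hb)
    obtain ⟨c, hbc, hc1⟩ := (h1.and self_mem_nhdsWithin).exists
    have hc1 : 1 < c := hc1
    have hc0 : 0 < c := zero_lt_one.trans hc1
    have hη : 0 < 1 - c⁻¹ := sub_pos.2 (inv_lt_one_of_one_lt₀ hc1)
    have h2 := (tendsto_tail_const_mul hα hc0.le hZ).add (hYZ _ hη)
    rw [add_zero] at h2
    filter_upwards [h2.eventually (gt_mem_nhds hbc), eventually_gt_atTop 0] with t ht ht0
    refine lt_of_le_of_lt ?_ ht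
    rw [← mul_add]
    refine mul_le_mul_of_nonneg_left ?_ (Real.rpow_nonneg ht0.le _)
    refine (measureReal_mono ?_).trans (measureReal_union_le _ _)
    intro ω hω
    by_contra hcon
    simp only [Set.mem_union, Set.mem_ofPred_eq, not_or, not_lt] at hcon hω
    have h3 := (abs_le.1 hcon.2).2
    have h4 : Z ω ≤ c⁻¹ * t := by
      rw [le_inv_mul_iff₀ hc0]; exact hcon.1
    linarith

/-- A tail of order `t ^ (-α)` is bounded by a multiple of `t ^ (-α)` on the whole half-line. -/
theorem exists_rpow_mul_tail_le [IsProbabilityMeasure P] (hα : 0 < α) {Y : Ω → ℝ} {C : ℝ}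
    (hY : Tendsto (fun t : ℝ => t ^ α * P.real {ω | t < Y ω}) atTop (𝓝 C)) :
    ∃ B, ∀ t > 0, t ^ α * P.real {ω | t < Y ω} ≤ B := by
  -- Beyond `t₀` the limit gives the bound `C + 1`; below it, a probability is at most 1 and `t ^ α
  -- ≤ t₀ ^ α`.
  obtain ⟨t₀, ht₀⟩ := eventually_atTop.1 (hY.eventually (ge_mem_nhds (lt_add_one C)))
  refine ⟨max (C + 1) (t₀ ^ α), fun t ht => ?_⟩
  rcases le_total t₀ t with h | h
  · exact (ht₀ t h).trans (le_max_left _ _)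
  · refine le_trans ?_ (le_max_right _ _)
    calc t ^ α * P.real {ω | t < Y ω} ≤ t ^ α * 1 :=
          mul_le_mul_of_nonneg_left measureReal_le_one (Real.rpow_nonneg ht.le _)
      _ ≤ t₀ ^ α := by rw [mul_one]; exact Real.rpow_le_rpow ht.le h hα.le

/-- The sup norm exceeds `t` only if some coordinate does, so the union bound applies. This crude
estimate serves three times: for the normalisation, for the truncation error and for the dominating
function. -/
theorem exists_rpow_mul_tail_norm_le [IsProbabilityMeasure P] (hα : 0 < α) {d : ℕ}
    {V : Ω → Fin d → ℝ} (hVnonneg : ∀ ω j, 0 ≤ V ω j) {K : Fin d → ℝ}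
    (hV : ∀ j, Tendsto (fun t : ℝ => t ^ α * P.real {ω | t < V ω j}) atTop (𝓝 (K j))) :
    ∃ B, 0 ≤ B ∧ ∀ t > 0, t ^ α * P.real {ω | t < ‖V ω‖} ≤ B := by
  choose B hB using fun j => exists_rpow_mul_tail_le hα (hV j)
  refine ⟨max (∑ j, B j) 0, le_max_right _ _, fun t ht => le_trans ?_ (le_max_left _ _)⟩
  calc t ^ α * P.real {ω | t < ‖V ω‖} ≤ t ^ α * P.real (⋃ j, {ω | t < V ω j}) := by
        refine mul_le_mul_of_nonneg_left (measureReal_mono ?_) (Real.rpow_nonneg ht.le _)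
        intro ω hω
        by_contra hcon
        simp only [Set.mem_iUnion, Set.mem_ofPred_eq, not_exists, not_lt] at hcon hω
        refine hω.not_ge ((pi_norm_le_iff_of_nonneg ht.le).2 fun j => ?_)
        rw [Real.norm_of_nonneg (hVnonneg ω j)]
        exact hcon j
    _ ≤ t ^ α * ∑ j, P.real {ω | t < V ω j} :=
        mul_le_mul_of_nonneg_left (measureReal_iUnion_fintype_le _) (Real.rpow_nonneg ht.le _)
    _ ≤ ∑ j, B j := by
        rw [Finset.mul_sum]
        exact Finset.sum_le_sum fun j _ => hB j t ht

theorem rpow_mul_tail_le_of_le [IsFiniteMeasure P] {X Y : Ω → ℝ} {B c : ℝ}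
    (hα : 0 < α) (hY : ∀ t > 0, t ^ α * P.real {ω | t < Y ω} ≤ B) (hc : 0 ≤ c)
    (hXY : ∀ ω, X ω ≤ c * Y ω) {t : ℝ} (ht : 0 < t) :
    t ^ α * P.real {ω | t < X ω} ≤ B * c ^ α := by
  rcases hc.eq_or_lt with rfl | hc
  · have : {ω | t < X ω} = ∅ := by
      ext ω
      have := hXY ω
      simp only [Set.mem_ofPred_eq, Set.mem_empty_iff_false, iff_false, not_lt]
      linarith
    rw [this, Real.zero_rpow hα.ne']
    simp
  · have hca : 0 < c ^ α := Real.rpow_pos_of_pos hc _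
    have h1 := hY (t / c) (div_pos ht hc)
    rw [Real.div_rpow ht.le hc.le, div_mul_eq_mul_div, div_le_iff₀ hca] at h1
    refine le_trans (mul_le_mul_of_nonneg_left (measureReal_mono ?_) (Real.rpow_nonneg ht.le _)) h1
    intro ω hω
    have hω : t < X ω := hω
    simp only [Set.mem_ofPred_eq, div_lt_iff₀ hc]
    linarith [hXY ω, mul_comm c (Y ω)]

end Tails

/-! ### Truncation on the compactified orthant -/

/-- Coordinatewise truncation `[0, ∞]^d → ℝ^d` at the levels `b`. -/
noncomputable def truncate {d : ℕ} (b : Fin d → ℝ) (x : Fin d → ℝ≥0∞) : Fin d → ℝ :=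
  fun i => (min (x i) (ENNReal.ofReal (b i))).toReal

theorem continuous_truncate {d : ℕ} (b : Fin d → ℝ) : Continuous (truncate b) := by
  refine continuous_pi fun i => ?_
  refine ENNReal.continuousOn_toReal.comp_continuous
    ((continuous_apply i).min continuous_const) fun x => ?_
  exact ne_top_of_le_ne_top ENNReal.ofReal_ne_top (min_le_right _ _)

theorem truncate_zero {d : ℕ} (b : Fin d → ℝ) : truncate b 0 = 0 := by
  ext i
  simp [truncate]

theorem truncate_ofReal {d : ℕ} {b v : Fin d → ℝ} (hv : ∀ i, 0 ≤ v i) (hb : ∀ i, v i ≤ b i) :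
    truncate b (fun i => ENNReal.ofReal (v i)) = v := by
  ext i
  simp [truncate, min_eq_left (ENNReal.ofReal_le_ofReal (hb i)), hv i]

/-- For `d = 0` the punctured orthant is empty and carries no nonzero measure. -/
theorem IsIntensityMeasure.dim_pos {Ω : Type*} [MeasurableSpace Ω]
    {P : Measure Ω} {d : ℕ} {V : Ω → Fin d → ℝ} {N : Seminorm ℝ (Fin d → ℝ)}
    {μ : Measure (PuncturedOrthant d)} (hμ : IsIntensityMeasure P N V μ) : 0 < d := by
  rcases Nat.eq_zero_or_pos d with rfl | hd
  · have : IsEmpty (PuncturedOrthant 0) := ⟨fun x => x.2 (Subsingleton.elim _ _)⟩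
    exact absurd (Measure.eq_zero_of_isEmpty μ) hμ.ne_zero
  · exact hd

/-! ### Functions vanishing on the carrier of the intensity measure -/

section Negligible

variable {Ω : Type*} [MeasurableSpace Ω] {P : Measure Ω} [IsProbabilityMeasure P] {d : ℕ} {α : ℝ}
  {V : Ω → Fin d → ℝ} {K : Fin d → ℝ} {N : Seminorm ℝ (Fin d → ℝ)}
  {μ : Measure (PuncturedOrthant d)}

theorem le_norm_of_unit (hNunit : ∀ j, N (Pi.single j 1) = 1) (x : Fin d → ℝ) :
    N x ≤ d * ‖x‖ := by
  have hx : x = ∑ j, x j • (Pi.single j 1 : Fin d → ℝ) := by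
    rw [← pi_eq_sum_univ' x]
  calc N x = N (∑ j, x j • (Pi.single j 1 : Fin d → ℝ)) := by rw [← hx]
    _ ≤ ∑ j, N (x j • (Pi.single j 1 : Fin d → ℝ)) :=
        Finset.le_sum_of_subadditive N (map_zero N).le (map_add_le_add N) _ _
    _ ≤ ∑ _j : Fin d, ‖x‖ := by
        refine Finset.sum_le_sum fun j _ => ?_
        rw [map_smul_eq_mul, hNunit, mul_one]
        exact norm_le_pi_norm x j
    _ = d * ‖x‖ := by simp

/-- `N V` dominates a positive multiple of one coordinate, whose Pareto tail never vanishes far out.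
Positivity permits cancelling the normalising factor of `rescaledTail`. -/
theorem eventually_tail_pos (hN : ∀ x, N x = 0 → x = 0) (hd : 0 < d)
    (hK : ∀ j, 0 < K j)
    (hV : ∀ j, Tendsto (fun t : ℝ => t ^ α * P.real {ω | t < V ω j}) atTop (𝓝 (K j))) :
    ∀ᶠ t : ℝ in atTop, 0 < P.real {ω | t < N (V ω)} := by
  obtain ⟨c, hc, hcN⟩ := exists_pos_mul_norm_le N hN
  have h1 := (tendsto_id.atTop_div_const hc).eventually
    ((hV ⟨0, hd⟩).eventually (lt_mem_nhds (hK ⟨0, hd⟩)))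
  filter_upwards [h1, eventually_gt_atTop 0] with t ht ht0
  have h2 : 0 < P.real {ω | t / c < V ω ⟨0, hd⟩} := by
    refine lt_of_le_of_ne measureReal_nonneg fun h => ?_
    simp only [id] at ht
    rw [← h, mul_zero] at ht
    exact lt_irrefl _ ht
  refine h2.trans_le (measureReal_mono fun ω hω => ?_)
  have hω : t / c < V ω ⟨0, hd⟩ := hω
  rw [div_lt_iff₀ hc] at hω
  have h3 := (le_abs_self (V ω ⟨0, hd⟩)).trans (norm_le_pi_norm (V ω) ⟨0, hd⟩)
  have h4 := hcN (V ω)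
  have h5 : c * V ω ⟨0, hd⟩ ≤ c * ‖V ω‖ := mul_le_mul_of_nonneg_left h3 hc.le
  show t < N (V ω)
  linarith [mul_comm c (V ω ⟨0, hd⟩)]

theorem measurableEmbedding_val : MeasurableEmbedding
    (Subtype.val : PuncturedOrthant d → (Fin d → ℝ≥0∞)) :=
  MeasurableEmbedding.subtype_coe (MeasurableSet.singleton 0).compl

theorem measurable_rescale (hVmeas : Measurable V) (t : ℝ) :
    Measurable fun ω (i : Fin d) => ENNReal.ofReal (V ω i / t) :=
  measurable_pi_lambda _ fun i =>
    (((measurable_pi_apply i).comp hVmeas).div_const t).ennreal_ofReal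

/-- Markov's inequality for the rescaled tail measure. -/
theorem mul_tail_le_mul_integral_rescaledTail (hVmeas : Measurable V) {t : ℝ}
    (ht : 0 < P.real {ω | t < N (V ω)}) {F : PuncturedOrthant d → ℝ} (hF : Continuous F)
    (hFc : HasCompactSupport F) (hF0 : ∀ x, 0 ≤ F x) (ε : ℝ) (hε : 0 ≤ ε) {s : Set Ω}
    (hs : ∀ ω ∈ s, ∃ x : PuncturedOrthant d,
      x.1 = (fun i => ENNReal.ofReal (V ω i / t)) ∧ ε ≤ F x) :
    ε * P.real s ≤
      P.real {ω | t < N (V ω)} * ∫ x, F x ∂(rescaledTail P N V t) := by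
  set ν := (P.map (fun ω i => ENNReal.ofReal (V ω i / t))).comap
      (Subtype.val : PuncturedOrthant d → (Fin d → ℝ≥0∞)) with hν
  have hint : ∫ x, F x ∂(rescaledTail P N V t) =
      (P.real {ω | t < N (V ω)})⁻¹ * ∫ x, F x ∂ν := by
    rw [rescaledTail, integral_smul_measure, ENNReal.toReal_inv, smul_eq_mul]
    rfl
  rw [hint, mul_inv_cancel_left₀ ht.ne']
  have hmeas := measurable_rescale hVmeas t
  have : IsProbabilityMeasure (P.map (fun ω (i : Fin d) => ENNReal.ofReal (V ω i / t))) :=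
    Measure.isProbabilityMeasure_map hmeas.aemeasurable
  have hFint : Integrable F ν := hF.integrable_of_hasCompactSupport hFc
  refine le_trans ?_ (mul_meas_ge_le_integral_of_nonneg (Eventually.of_forall hF0) hFint ε)
  refine mul_le_mul_of_nonneg_left ?_ hε
  refine ENNReal.toReal_mono (measure_ne_top _ _) ?_
  have hms : MeasurableSet {x | ε ≤ F x} := measurableSet_le measurable_const hF.measurable
  rw [hν, measurableEmbedding_val.comap_apply,
    Measure.map_apply hmeas (measurableEmbedding_val.measurableSet_image.2 hms)]
  refine measure_mono fun ω hω => ?_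
  obtain ⟨x, hx, hxF⟩ := hs ω hω
  exact ⟨x, hxF, hx⟩

/-- The test function `max (f ∘ truncate b - ε) 0` on the punctured orthant. -/
theorem hasCompactSupport_max_truncate {f : (Fin d → ℝ) → ℝ} (hf : Continuous f)
    (hf0 : f 0 = 0) (b : Fin d → ℝ) {ε : ℝ} (hε : 0 < ε) :
    HasCompactSupport fun x : PuncturedOrthant d => max (f (truncate b x.1) - ε) 0 := by
  -- This set is closed in the compact cube `[0, ∞]^d` and misses the origin, where `f` is zero;
  -- hence it is compact in the punctured orthant.
  have hclosed : IsClosed {x : Fin d → ℝ≥0∞ | ε ≤ f (truncate b x)} :=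
    isClosed_le continuous_const (hf.comp (continuous_truncate b))
  refine HasCompactSupport.intro
    (K := Subtype.val ⁻¹' {x : Fin d → ℝ≥0∞ | ε ≤ f (truncate b x)}) ?_ fun x hx => ?_
  · refine (Topology.IsInducing.subtypeVal.isCompact_preimage_iff ?_).2 hclosed.isCompact
    rintro x hx
    refine ⟨⟨x, ?_⟩, rfl⟩
    rintro rfl
    have hx : ε ≤ f (truncate b 0) := hx
    rw [truncate_zero, hf0] at hx
    linarith
  · have hx : ¬ ε ≤ f (truncate b x.1) := hx
    exact max_eq_right (by linarith)

/-- If a continuous homogeneous function vanishes almost everywhere on the truncations at the levels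
`b`, then it has negligible tail on the event that `V` stays below these levels. -/
theorem tendsto_tail_inter_of_ae_zero (hα : 0 < α) (hVmeas : Measurable V)
    (hVnonneg : ∀ ω j, 0 ≤ V ω j) (hK : ∀ j, 0 < K j)
    (hV : ∀ j, Tendsto (fun t : ℝ => t ^ α * P.real {ω | t < V ω j}) atTop (𝓝 (K j)))
    (hN : ∀ x, N x = 0 → x = 0) (hNunit : ∀ j, N (Pi.single j 1) = 1)
    (hμ : IsIntensityMeasure P N V μ)
    {f : (Fin d → ℝ) → ℝ} (hf : Continuous f) (hom : ∀ (c : ℝ) x, 0 < c → f (c • x) = c * f x)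
    {b : Fin d → ℝ} (hfb : ∀ᵐ x ∂μ, f (truncate b x.1) = 0) {r : ℝ} (hr : ∀ i, r ≤ b i)
    {η : ℝ} (hη : 0 < η) :
    Tendsto (fun t : ℝ => t ^ α * P.real {ω | η * t < f (V ω) ∧ ‖V ω‖ ≤ r * t})
      atTop (𝓝 0) := by
  have hf0 : f 0 = 0 := map_zero_of_homogeneous hom
  obtain ⟨B, hB0, hB⟩ := exists_rpow_mul_tail_norm_le hα hVnonneg hV
  set F : PuncturedOrthant d → ℝ := fun x => max (f (truncate b x.1) - η / 2) 0 with hFdef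
  have hFcont : Continuous F :=
    (((hf.comp (continuous_truncate b)).comp continuous_subtype_val).sub continuous_const).max
      continuous_const
  have hFc : HasCompactSupport F := hasCompactSupport_max_truncate hf hf0 b (half_pos hη)
  have hlim := hμ.vague F hFcont hFc
  have hzero : ∫ x, F x ∂μ = 0 := by
    refine integral_eq_zero_of_ae ?_
    filter_upwards [hfb] with x hx
    simp [hFdef, hx, (half_pos hη).le]
  rw [hzero] at hlim
  -- The factor `2 / η` comes from Markov's inequality at level `η / 2`, and `B * d ^ α` bounds `t ^
  -- α * P(N V > t)`, since `N` is at most `d` times the sup norm.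
  have hlim2 := hlim.const_mul (2 / η * (B * (d : ℝ) ^ α))
  rw [mul_zero] at hlim2
  refine squeeze_zero' ?_ ?_ hlim2
  · filter_upwards [eventually_gt_atTop 0] with t ht
    exact mul_nonneg (Real.rpow_nonneg ht.le _) measureReal_nonneg
  · filter_upwards [eventually_gt_atTop 0, eventually_tail_pos hN hμ.dim_pos hK hV]
      with t ht hpt
    have hmarkov := mul_tail_le_mul_integral_rescaledTail (N := N) hVmeas hpt hFcont hFc
      (fun x => le_max_right _ _) (η / 2) (half_pos hη).le
      (s := {ω | η * t < f (V ω) ∧ ‖V ω‖ ≤ r * t}) (by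
        rintro ω ⟨h1, h2⟩
        -- On this event every coordinate of `V / t` is at most `r ≤ b i`, so the truncation is
        -- inactive and the test function sees `f (V / t) > η`.
        have hVt : t⁻¹ • V ω = fun i => V ω i / t := by
          ext i; simp [div_eq_inv_mul]
        have htr : truncate b (fun i => ENNReal.ofReal (V ω i / t)) = t⁻¹ • V ω := by
          rw [hVt]
          refine truncate_ofReal (fun i => div_nonneg (hVnonneg ω i) ht.le) fun i => ?_
          rw [div_le_iff₀ ht]
          have h3 := (le_abs_self (V ω i)).trans ((norm_le_pi_norm (V ω) i).trans h2)
          exact h3.trans (mul_le_mul_of_nonneg_right (hr i) ht.le)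
        have hft : η < f (t⁻¹ • V ω) := by
          rw [hom _ _ (inv_pos.2 ht), lt_inv_mul_iff₀ ht, mul_comm]
          exact h1
        refine ⟨⟨fun i => ENNReal.ofReal (V ω i / t), ?_⟩, rfl, ?_⟩
        · intro h0
          rw [h0, truncate_zero] at htr
          rw [← htr, hf0] at hft
          linarith
        · refine le_trans ?_ (le_max_left _ _)
          show η / 2 ≤ f (truncate b (fun i => ENNReal.ofReal (V ω i / t))) - η / 2
          rw [htr]
          linarith)
    have hp := rpow_mul_tail_le_of_le (X := fun ω => N (V ω)) hα hB (Nat.cast_nonneg d)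
      (fun ω => le_norm_of_unit hNunit (V ω)) ht
    have hI : 0 ≤ ∫ x, F x ∂(rescaledTail P N V t) :=
      integral_nonneg fun x => le_max_right _ _
    have hta : 0 ≤ t ^ α := Real.rpow_nonneg ht.le _
    set p := P.real {ω | t < N (V ω)}
    set I := ∫ x, F x ∂(rescaledTail P N V t)
    set q := P.real {ω | η * t < f (V ω) ∧ ‖V ω‖ ≤ r * t}
    have hq : q ≤ 2 / η * (p * I) := by
      calc q = 2 / η * (η / 2 * q) := by field_simp
        _ ≤ 2 / η * (p * I) := mul_le_mul_of_nonneg_left hmarkov (by positivity)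
    calc t ^ α * q ≤ t ^ α * (2 / η * (p * I)) := mul_le_mul_of_nonneg_left hq hta
      _ = 2 / η * (t ^ α * p * I) := by ring
      _ ≤ 2 / η * (B * (d : ℝ) ^ α * I) := by gcongr
      _ = 2 / η * (B * (d : ℝ) ^ α) * I := by ring

/-- A continuous homogeneous function vanishing on the truncations, along a fixed direction `w`, of
almost every point has negligible tail. -/
theorem tendsto_tail_of_ae_zero (hα : 0 < α) (hVmeas : Measurable V)
    (hVnonneg : ∀ ω j, 0 ≤ V ω j) (hK : ∀ j, 0 < K j)
    (hV : ∀ j, Tendsto (fun t : ℝ => t ^ α * P.real {ω | t < V ω j}) atTop (𝓝 (K j)))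
    (hN : ∀ x, N x = 0 → x = 0) (hNunit : ∀ j, N (Pi.single j 1) = 1)
    (hμ : IsIntensityMeasure P N V μ)
    {f : (Fin d → ℝ) → ℝ} (hf : Continuous f) (hom : ∀ (c : ℝ) x, 0 < c → f (c • x) = c * f x)
    {w : Fin d → ℝ} (hw : ∀ i, 0 < w i)
    (hfw : ∀ R : ℝ, 0 < R → ∀ᵐ x ∂μ, f (truncate (R • w) x.1) = 0) {η : ℝ} (hη : 0 < η) :
    Tendsto (fun t : ℝ => t ^ α * P.real {ω | η * t < f (V ω)}) atTop (𝓝 0) := by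
  obtain ⟨B, hB0, hB⟩ := exists_rpow_mul_tail_norm_le hα hVnonneg hV
  obtain ⟨m, hm, hmw⟩ : ∃ m > 0, ∀ i, m ≤ w i := by
    have : Nonempty (Fin d) := ⟨⟨0, hμ.dim_pos⟩⟩
    obtain ⟨i, hi⟩ := Finite.exists_min w
    exact ⟨w i, hw i, hi⟩
  refine tendsto_order.2 ⟨fun a ha => ?_, fun ε hε => ?_⟩
  · filter_upwards [eventually_gt_atTop 0] with t ht
    exact ha.trans_le (mul_nonneg (Real.rpow_nonneg ht.le _) measureReal_nonneg)
  -- Choose `r` so that `‖V‖ > r t` contributes less than `ε / 2`, uniformly in `t`. The multiple `r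
  -- / m` of `w` then lies above `r` in every coordinate.
  · have h1 : Tendsto (fun r : ℝ => B * r ^ (-α)) atTop (𝓝 0) := by
      simpa using (tendsto_rpow_neg_atTop hα).const_mul B
    obtain ⟨r, hrB, hr⟩ :=
      ((h1.eventually (gt_mem_nhds (half_pos hε))).and (eventually_gt_atTop (0 : ℝ))).exists
    have hfb := hfw (r / m) (div_pos hr hm)
    have hrb : ∀ i, r ≤ ((r / m) • w) i := fun i => by
      rw [Pi.smul_apply, smul_eq_mul, div_mul_eq_mul_div, le_div_iff₀ hm]
      exact mul_le_mul_of_nonneg_left (hmw i) hr.le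
    have h2 := tendsto_tail_inter_of_ae_zero hα hVmeas hVnonneg hK hV hN hNunit hμ hf hom hfb hrb hη
    filter_upwards [h2.eventually (gt_mem_nhds (half_pos hε)), eventually_gt_atTop 0]
      with t ht ht0
    have hta : 0 ≤ t ^ α := Real.rpow_nonneg ht0.le _
    have h3 : t ^ α * P.real {ω | r * t < ‖V ω‖} ≤ B * r ^ (-α) := by
      have h4 := hB (r * t) (mul_pos hr ht0)
      rw [Real.mul_rpow hr.le ht0.le, mul_assoc] at h4
      rwa [Real.rpow_neg hr.le, ← div_eq_mul_inv, le_div_iff₀ (Real.rpow_pos_of_pos hr _),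
        mul_comm]
    have h5 : P.real {ω | η * t < f (V ω)} ≤
        P.real {ω | η * t < f (V ω) ∧ ‖V ω‖ ≤ r * t} + P.real {ω | r * t < ‖V ω‖} := by
      refine (measureReal_mono fun ω hω => ?_).trans (measureReal_union_le _ _)
      rcases le_or_gt ‖V ω‖ (r * t) with h | h
      · exact Or.inl ⟨hω, h⟩
      · exact Or.inr h
    have h6 := mul_le_mul_of_nonneg_left h5 hta
    rw [mul_add] at h6
    linarith

end Negligible

/-! ### Tails for a fixed homogeneous function -/

section Homogeneous

/-- A Bonferroni bound: removing from each set all the others leaves disjoint pieces inside the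
union, and what is removed lies in pairwise intersections. Each pair is counted twice, which is
harmless as these terms are negligible. -/
theorem sum_measureReal_le_iUnion_add {Ω ι : Type*} [MeasurableSpace Ω] {P : Measure Ω}
    [IsFiniteMeasure P] [Fintype ι] [DecidableEq ι] {A : ι → Set Ω}
    (hA : ∀ i, MeasurableSet (A i)) :
    ∑ i, P.real (A i) ≤
      P.real (⋃ i, A i) + ∑ i, ∑ j, if i = j then 0 else P.real (A i ∩ A j) := by
  set B : ι → Set Ω := fun i => A i \ ⋃ j, if i = j then ∅ else A j with hBdef
  have hBm : ∀ i, MeasurableSet (B i) := fun i =>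
    (hA i).diff (MeasurableSet.iUnion fun j => by
      split_ifs
      · exact MeasurableSet.empty
      · exact hA j)
  have hBd : Pairwise (Function.onFun Disjoint B) := by
    intro i j hij
    refine Set.disjoint_left.2 fun ω hi hj => hi.2 ?_
    exact Set.mem_iUnion.2 ⟨j, by rw [if_neg hij]; exact hj.1⟩
  have h1 : ∀ i, P.real (A i) ≤
      P.real (B i) + ∑ j, if i = j then 0 else P.real (A i ∩ A j) := by
    intro i
    have hsub : A i ⊆ B i ∪ ⋃ j, if i = j then ∅ else A i ∩ A j := by
      intro ω hω
      by_cases h : ω ∈ ⋃ j, if i = j then ∅ else A j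
      · right
        obtain ⟨j, hj⟩ := Set.mem_iUnion.1 h
        refine Set.mem_iUnion.2 ⟨j, ?_⟩
        by_cases hij : i = j
        · rw [if_pos hij] at hj
          exact hj.elim
        · rw [if_neg hij] at hj ⊢
          exact ⟨hω, hj⟩
      · exact Or.inl ⟨hω, h⟩
    refine ((measureReal_mono hsub).trans (measureReal_union_le _ _)).trans ?_
    gcongr
    refine (measureReal_iUnion_fintype_le _).trans (Finset.sum_le_sum fun j _ => ?_)
    split_ifs <;> simp
  calc ∑ i, P.real (A i)
      ≤ ∑ i, (P.real (B i) + ∑ j, if i = j then 0 else P.real (A i ∩ A j)) :=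
        Finset.sum_le_sum fun i _ => h1 i
    _ = P.real (⋃ i, B i) + ∑ i, ∑ j, if i = j then 0 else P.real (A i ∩ A j) := by
        rw [Finset.sum_add_distrib, measureReal_iUnion_fintype hBd hBm]
    _ ≤ _ := by
        gcongr
        · exact measure_ne_top _ _
        · exact Set.sdiff_subset

variable {Ω : Type*} [MeasurableSpace Ω] {P : Measure Ω} [IsProbabilityMeasure P] {d : ℕ} {α : ℝ}
  {V : Ω → Fin d → ℝ} {K : Fin d → ℝ} {N : Seminorm ℝ (Fin d → ℝ)}
  {μ : Measure (PuncturedOrthant d)}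

/-- Two continuous homogeneous functions that agree on the truncations of almost every point have
the same tails. -/
theorem tendsto_tail_of_ae_eq (hα : 0 < α) (hVmeas : Measurable V)
    (hVnonneg : ∀ ω j, 0 ≤ V ω j) (hK : ∀ j, 0 < K j)
    (hV : ∀ j, Tendsto (fun t : ℝ => t ^ α * P.real {ω | t < V ω j}) atTop (𝓝 (K j)))
    (hN : ∀ x, N x = 0 → x = 0) (hNunit : ∀ j, N (Pi.single j 1) = 1)
    (hμ : IsIntensityMeasure P N V μ)
    {g k : (Fin d → ℝ) → ℝ} (hg : Continuous g) (hgom : ∀ (c : ℝ) x, 0 < c → g (c • x) = c * g x)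
    (hk : Continuous k) (hkom : ∀ (c : ℝ) x, 0 < c → k (c • x) = c * k x)
    {w : Fin d → ℝ} (hw : ∀ i, 0 < w i)
    (hgk : ∀ R : ℝ, 0 < R → ∀ᵐ x ∂μ, g (truncate (R • w) x.1) = k (truncate (R • w) x.1))
    {C : ℝ} (hkV : Tendsto (fun t : ℝ => t ^ α * P.real {ω | t < k (V ω)}) atTop (𝓝 C)) :
    Tendsto (fun t : ℝ => t ^ α * P.real {ω | t < g (V ω)}) atTop (𝓝 C) := by
  refine tendsto_tail_of_negligible_diff hα hkV fun η hη => ?_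
  refine tendsto_tail_of_ae_zero (f := fun x => |g x - k x|) hα hVmeas hVnonneg hK hV hN hNunit hμ
    (hg.sub hk).abs (fun c x hc => ?_) hw (fun R hR => ?_) hη
  · rw [hgom c x hc, hkom c x hc, ← mul_sub, abs_mul, abs_of_pos hc]
  · filter_upwards [hgk R hR] with x hx
    rw [hx, sub_self, abs_zero]

theorem AsympIndependent.ae_truncate (h : AsympIndependent μ) (b : Fin d → ℝ) :
    ∀ᵐ x ∂μ, ∀ i j, i ≠ j → truncate b x.1 i = 0 ∨ truncate b x.1 j = 0 := by
  have h' : ∀ᵐ x ∂μ, ¬ ∃ i j, i ≠ j ∧ x.1 i ≠ 0 ∧ x.1 j ≠ 0 := by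
    rw [ae_iff]
    simp only [not_not]
    exact h
  filter_upwards [h'] with x hx i j hij
  have key : ∀ l, x.1 l = 0 → truncate b x.1 l = 0 := fun l hl => by simp [truncate, hl]
  by_cases hi : x.1 i = 0
  · exact Or.inl (key i hi)
  · by_cases hj : x.1 j = 0
    · exact Or.inr (key j hj)
    · exact absurd ⟨i, j, hij, hi, hj⟩ hx

theorem truncate_nonneg (b : Fin d → ℝ) (x : Fin d → ℝ≥0∞) (i : Fin d) : 0 ≤ truncate b x i :=
  ENNReal.toReal_nonneg

theorem exists_eq_smul_single_of_pairwise {y : Fin d → ℝ} (hy0 : ∀ i, 0 ≤ y i)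
    (hy : ∀ i j, i ≠ j → y i = 0 ∨ y j = 0) (hne : y ≠ 0) :
    ∃ (i : Fin d) (s : ℝ), 0 < s ∧ y = s • (Pi.single i 1 : Fin d → ℝ) := by
  obtain ⟨i, hi⟩ := Function.ne_iff.1 hne
  refine ⟨i, y i, lt_of_le_of_ne (hy0 i) (Ne.symm hi), ?_⟩
  ext j
  by_cases hij : j = i
  · subst hij
    simp
  · have := (hy i j (Ne.symm hij)).resolve_left hi
    simp [this, hij]

/-- Tail of the weighted maximum of asymptotically independent components. -/
theorem AsympIndependent.tendsto_tail_norm (hα : 0 < α) (hVmeas : Measurable V)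
    (hVnonneg : ∀ ω j, 0 ≤ V ω j) (hK : ∀ j, 0 < K j)
    (hV : ∀ j, Tendsto (fun t : ℝ => t ^ α * P.real {ω | t < V ω j}) atTop (𝓝 (K j)))
    (hN : ∀ x, N x = 0 → x = 0) (hNunit : ∀ j, N (Pi.single j 1) = 1)
    (hμ : IsIntensityMeasure P N V μ) (hind : AsympIndependent μ)
    {c : Fin d → ℝ} (hc : ∀ j, 0 ≤ c j) :
    Tendsto (fun t : ℝ => t ^ α * P.real {ω | t < ‖fun j => c j * V ω j‖}) atTop
      (𝓝 (∑ j, K j * c j ^ α)) := by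
  classical
  have hsum := tendsto_finsetSum Finset.univ fun j _ => tendsto_tail_const_mul hα (hc j) (hV j)
  have hpair : ∀ i j, i ≠ j → Tendsto (fun t : ℝ => t ^ α *
      P.real ({ω | t < c i * V ω i} ∩ {ω | t < c j * V ω j})) atTop (𝓝 0) := by
    intro i j hij
    -- A joint exceedance is an exceedance of the minimum, a homogeneous function that vanishes on
    -- the axes.
    have := tendsto_tail_of_ae_zero (f := fun x => min (c i * x i) (c j * x j)) (η := 1)
      (w := fun _ => 1) hα hVmeas hVnonneg hK hV hN hNunit hμ (by fun_prop) (fun r x hr => by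
        rw [mul_min_of_nonneg _ _ hr.le]
        simp only [Pi.smul_apply, smul_eq_mul]
        congr 1 <;> ring) (fun _ => one_pos) (fun R _ => by
        filter_upwards [hind.ae_truncate (R • fun _ => 1)] with x hx
        have h1 := mul_nonneg (hc i) (truncate_nonneg (R • fun _ => (1 : ℝ)) x.1 i)
        have h2 := mul_nonneg (hc j) (truncate_nonneg (R • fun _ => (1 : ℝ)) x.1 j)
        rcases hx i j hij with h | h
        · rw [h, mul_zero, min_eq_left h2]
        · rw [h, mul_zero, min_eq_right h1]) one_pos
    simp only [one_mul, lt_min_iff] at this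
    exact this
  have hpairs := tendsto_finsetSum (Finset.univ : Finset (Fin d)) fun i _ =>
    tendsto_finsetSum (Finset.univ : Finset (Fin d)) fun j _ =>
      show Tendsto (fun t : ℝ => t ^ α * if i = j then 0 else
        P.real ({ω | t < c i * V ω i} ∩ {ω | t < c j * V ω j})) atTop (𝓝 0) by
      by_cases hij : i = j
      · simp [hij]
      · simpa [hij] using hpair i j hij
  have hlow := hsum.sub hpairs
  simp only [Finset.sum_const_zero, sub_zero] at hlow
  have hunion : ∀ t > 0, {ω | t < ‖fun j => c j * V ω j‖} = ⋃ j, {ω | t < c j * V ω j} := by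
    intro t ht
    ext ω
    rw [← not_iff_not]
    simp only [Set.mem_iUnion, Set.mem_ofPred_eq, not_exists, not_lt]
    rw [pi_norm_le_iff_of_nonneg (le_of_lt ht)]
    refine forall_congr' fun j => ?_
    rw [Real.norm_of_nonneg (mul_nonneg (hc j) (hVnonneg ω j))]
  refine tendsto_of_tendsto_of_tendsto_of_le_of_le' hlow hsum ?_ ?_
  · filter_upwards [eventually_gt_atTop 0] with t ht
    have hta : 0 ≤ t ^ α := Real.rpow_nonneg ht.le _
    rw [hunion t ht]
    simp only [← Finset.mul_sum]
    rw [← mul_sub]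
    refine mul_le_mul_of_nonneg_left ?_ hta
    rw [sub_le_iff_le_add]
    refine sum_measureReal_le_iUnion_add fun j => ?_
    exact measurableSet_lt measurable_const
      (((measurable_pi_apply j).comp hVmeas).const_mul (c j))
  · filter_upwards [eventually_gt_atTop 0] with t ht
    rw [hunion t ht, ← Finset.mul_sum]
    exact mul_le_mul_of_nonneg_left (measureReal_iUnion_fintype_le _) (Real.rpow_nonneg ht.le _)

/-- Tail of a homogeneous function of asymptotically independent components. -/
theorem AsympIndependent.tendsto_tail (hα : 0 < α) (hVmeas : Measurable V)
    (hVnonneg : ∀ ω j, 0 ≤ V ω j) (hK : ∀ j, 0 < K j)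
    (hV : ∀ j, Tendsto (fun t : ℝ => t ^ α * P.real {ω | t < V ω j}) atTop (𝓝 (K j)))
    (hN : ∀ x, N x = 0 → x = 0) (hNunit : ∀ j, N (Pi.single j 1) = 1)
    (hμ : IsIntensityMeasure P N V μ) (hind : AsympIndependent μ)
    {g : (Fin d → ℝ) → ℝ} (hg : Continuous g) (hgom : ∀ (c : ℝ) x, 0 < c → g (c • x) = c * g x)
    (hg0 : ∀ x, 0 ≤ g x) :
    Tendsto (fun t : ℝ => t ^ α * P.real {ω | t < g (V ω)}) atTop
      (𝓝 (∑ j, K j * g (Pi.single j 1) ^ α)) := by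
  have hc : ∀ j, 0 ≤ g (Pi.single j (1 : ℝ)) := fun j => hg0 _
  refine tendsto_tail_of_ae_eq (k := fun x => ‖fun j => g (Pi.single j 1) * x j‖)
    (w := fun _ => 1) hα hVmeas hVnonneg hK hV hN hNunit hμ hg hgom (by fun_prop)
    (fun r x hr => ?_) (fun _ => one_pos) (fun R _ => ?_)
    (hind.tendsto_tail_norm hα hVmeas hVnonneg hK hV hN hNunit hμ hc)
  · have : (fun j => g (Pi.single j 1) * (r • x) j) = r • fun j => g (Pi.single j 1) * x j := by
      ext j
      simp only [Pi.smul_apply, smul_eq_mul]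
      ring
    rw [this, norm_smul, Real.norm_of_nonneg hr.le]
  · filter_upwards [hind.ae_truncate (R • fun _ => 1)] with x hx
    have hy0 := truncate_nonneg (R • fun _ => 1) x.1
    generalize truncate (R • fun _ => 1) x.1 = y at hx hy0 ⊢
    by_cases hy : y = 0
    · have h0 : (fun j => g (Pi.single j 1) * (0 : Fin d → ℝ) j) = 0 := by ext j; simp
      rw [hy, h0, norm_zero, map_zero_of_homogeneous hgom]
    · obtain ⟨i, s, hs, hys⟩ := exists_eq_smul_single_of_pairwise hy0 hx hy
      have h1 : (fun j => g (Pi.single j 1) * y j) =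
          (s * g (Pi.single i 1)) • (Pi.single i 1 : Fin d → ℝ) := by
        ext j
        rw [hys]
        by_cases hij : j = i
        · subst hij
          simp [mul_comm]
        · simp [hij]
      rw [h1, norm_smul, Pi.norm_single, norm_one, mul_one,
        Real.norm_of_nonneg (mul_nonneg hs.le (hg0 _)), hys, hgom _ _ hs]

/-- Truncation levels proportional to `w` keep the ray invariant: the point `s • w` becomes `min s R
• w`. Equal levels in all coordinates could leave the ray. -/
theorem AsympFullyDependent.ae_truncate {w : Fin d → ℝ} (hw : ∀ j, w j = K j ^ (1 / α))
    (hw0 : ∀ j, 0 < w j) (h : AsympFullyDependent μ K α) {R : ℝ} (hR : 0 < R) :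
    ∀ᵐ x ∂μ, ∃ s : ℝ, 0 < s ∧ truncate (R • w) x.1 = s • w := by
  have h' : ∀ᵐ x ∂μ, ∃ s : ℝ, 0 < s ∧ ∀ j, x.1 j = ENNReal.ofReal (s * K j ^ (1 / α)) := by
    rw [ae_iff]
    exact h
  filter_upwards [h'] with x hx
  obtain ⟨s, hs, hx⟩ := hx
  refine ⟨min s R, lt_min hs hR, ?_⟩
  ext j
  rw [truncate, hx, ← hw j, Pi.smul_apply, Pi.smul_apply, smul_eq_mul, smul_eq_mul,
    ← ENNReal.ofReal_min, ← min_mul_of_nonneg _ _ (hw0 j).le,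
    ENNReal.toReal_ofReal (mul_nonneg (lt_min hs hR).le (hw0 j).le)]

/-- Tail of a homogeneous function of asymptotically fully dependent components. -/
theorem AsympFullyDependent.tendsto_tail (hα : 0 < α) (hVmeas : Measurable V)
    (hVnonneg : ∀ ω j, 0 ≤ V ω j) (hK : ∀ j, 0 < K j)
    (hV : ∀ j, Tendsto (fun t : ℝ => t ^ α * P.real {ω | t < V ω j}) atTop (𝓝 (K j)))
    (hN : ∀ x, N x = 0 → x = 0) (hNunit : ∀ j, N (Pi.single j 1) = 1)
    (hμ : IsIntensityMeasure P N V μ) (hdep : AsympFullyDependent μ K α)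
    {g : (Fin d → ℝ) → ℝ} (hg : Continuous g) (hgom : ∀ (c : ℝ) x, 0 < c → g (c • x) = c * g x)
    (hg0 : ∀ x, 0 ≤ g x) :
    Tendsto (fun t : ℝ => t ^ α * P.real {ω | t < g (V ω)}) atTop
      (𝓝 (g (fun j => K j ^ (1 / α)) ^ α)) := by
  set w : Fin d → ℝ := fun j => K j ^ (1 / α) with hw
  have hw0 : ∀ j, 0 < w j := fun j => Real.rpow_pos_of_pos (hK j) _
  set i : Fin d := ⟨0, hμ.dim_pos⟩
  have hwi : w i ^ α = K i := by
    rw [hw, ← Real.rpow_mul (hK i).le, one_div_mul_cancel hα.ne', Real.rpow_one]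
  -- The constant is `K i * (g w / w i) ^ α`, which equals `g w ^ α` because `w i ^ α = K i`; the
  -- choice of `i` is immaterial.
  have htail := tendsto_tail_const_mul hα (div_nonneg (hg0 w) (hw0 i).le) (hV i)
  rw [Real.div_rpow (hg0 w) (hw0 i).le, hwi, mul_div_cancel₀ _ (hK i).ne'] at htail
  refine tendsto_tail_of_ae_eq (k := fun x => g w / w i * x i) hα hVmeas hVnonneg hK hV hN hNunit hμ
    hg hgom (by fun_prop) (fun r x hr => ?_) hw0 (fun R hR => ?_) htail
  · simp only [Pi.smul_apply, smul_eq_mul]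
    ring
  · filter_upwards [hdep.ae_truncate (fun _ => rfl) hw0 hR] with x hx
    obtain ⟨s, hs, hx⟩ := hx
    rw [hx, hgom _ _ hs, Pi.smul_apply, smul_eq_mul]
    have := (hw0 i).ne'
    field_simp
    rfl

end Homogeneous

/-! ### Averaging over the independent random matrix -/

section Mixture

variable {Ω : Type*} [MeasurableSpace Ω] {P : Measure Ω} {q d : ℕ}
  {α : ℝ} {V : Ω → Fin d → ℝ} {A : Ω → Fin q → Fin d → ℝ} {h : (Fin q → ℝ) → ℝ}

theorem continuous_mulVec_of : Continuous fun p : (Fin d → ℝ) × (Fin q → Fin d → ℝ) =>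
    Matrix.of p.2 *ᵥ p.1 := by
  refine continuous_pi fun i => ?_
  simp only [Matrix.mulVec, dotProduct, Matrix.of_apply]
  fun_prop

/-- Fubini for the tail of a function of `V` and an independent random matrix. -/
theorem integral_tail_of_indepFun [IsProbabilityMeasure P] (hVmeas : Measurable V) (hA : Measurable A)
    (hindep : IndepFun V A P) (hh : Continuous h) (t : ℝ) :
    Measurable (fun ω' => P.real {ω | t < h (Matrix.of (A ω') *ᵥ V ω)}) ∧
    P.real {ω | t < h (Matrix.of (A ω) *ᵥ V ω)} =
      ∫ ω', P.real {ω | t < h (Matrix.of (A ω') *ᵥ V ω)} ∂P := by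
  have hS : MeasurableSet {p : (Fin d → ℝ) × (Fin q → Fin d → ℝ) |
      t < h (Matrix.of p.2 *ᵥ p.1)} :=
    (isOpen_lt continuous_const (hh.comp continuous_mulVec_of)).measurableSet
  have := Measure.isProbabilityMeasure_map (μ := P) hVmeas.aemeasurable
  have := Measure.isProbabilityMeasure_map (μ := P) hA.aemeasurable
  have hm := measurable_measure_prodMk_right (μ := P.map V) hS
  have heq : ∀ ω', P {ω | t < h (Matrix.of (A ω') *ᵥ V ω)} =
      P.map V ((fun v => (v, A ω')) ⁻¹' {p : (Fin d → ℝ) × (Fin q → Fin d → ℝ) |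
        t < h (Matrix.of p.2 *ᵥ p.1)}) := fun ω' => by
    rw [Measure.map_apply hVmeas (measurable_prodMk_right hS)]
    rfl
  have hmeas : Measurable fun ω' => P {ω | t < h (Matrix.of (A ω') *ᵥ V ω)} := by
    simp only [heq]
    exact hm.comp hA
  refine ⟨hmeas.ennreal_toReal, ?_⟩
  have h1 : P {ω | t < h (Matrix.of (A ω) *ᵥ V ω)} =
      ∫⁻ ω', P {ω | t < h (Matrix.of (A ω') *ᵥ V ω)} ∂P := by
    have h2 : P {ω | t < h (Matrix.of (A ω) *ᵥ V ω)} = P.map (fun ω => (V ω, A ω))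
        {p : (Fin d → ℝ) × (Fin q → Fin d → ℝ) | t < h (Matrix.of p.2 *ᵥ p.1)} := by
      rw [Measure.map_apply (hVmeas.prodMk hA) hS]
      rfl
    -- Independence turns the joint law into a product, which is integrated over `V` first with the
    -- matrix frozen.
    rw [h2, (indepFun_iff_map_prod_eq_prod_map_map hVmeas.aemeasurable hA.aemeasurable).1 hindep,
      Measure.prod_apply_symm hS, lintegral_map hm hA]
    simp only [heq]
  simp only [Measure.real]
  rw [h1, integral_toReal hmeas.aemeasurable (Eventually.of_forall fun _ => measure_lt_top _ _)]

/-- The tail constants of `h (a V)` may be averaged over an independent random matrix. -/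
theorem tendsto_tail_mulVec_of_indepFun [IsProbabilityMeasure P] (hα : 0 < α) (hVmeas : Measurable V)
    (hVnonneg : ∀ ω j, 0 ≤ V ω j) {K : Fin d → ℝ}
    (hV : ∀ j, Tendsto (fun t : ℝ => t ^ α * P.real {ω | t < V ω j}) atTop (𝓝 (K j)))
    (hA : Measurable A) (hindep : IndepFun V A P)
    (hAint : Integrable (fun ω => ‖A ω‖ ^ α) P)
    (hh : Continuous h) (hom : ∀ (c : ℝ) x, 0 < c → h (c • x) = c * h x)
    {L : (Fin q → Fin d → ℝ) → ℝ}
    (hL : ∀ a, Tendsto (fun t : ℝ => t ^ α * P.real {ω | t < h (Matrix.of a *ᵥ V ω)})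
      atTop (𝓝 (L a))) :
    Tendsto (fun t : ℝ => t ^ α * P.real {ω | t < h (Matrix.of (A ω) *ᵥ V ω)})
      atTop (𝓝 (∫ ω, L (A ω) ∂P)) := by
  obtain ⟨B, hB0, hB⟩ := exists_rpow_mul_tail_norm_le hα hVnonneg hV
  obtain ⟨H, hH0, hH⟩ := exists_abs_le_mul_norm hh hom
  have hfub : ∀ t, t ^ α * P.real {ω | t < h (Matrix.of (A ω) *ᵥ V ω)} =
      ∫ ω', t ^ α * P.real {ω | t < h (Matrix.of (A ω') *ᵥ V ω)} ∂P := fun t => by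
    rw [(integral_tail_of_indepFun hVmeas hA hindep hh t).2, integral_const_mul]
  simp only [hfub]
  refine tendsto_integral_filter_of_dominated_convergence
    -- Here `|h (a v)| ≤ H * d * ‖a‖ * ‖v‖`, and `B` bounds the tail of `‖V‖` for every `t > 0`.
    (fun ω => B * (H * d) ^ α * ‖A ω‖ ^ α) ?_ ?_ (hAint.const_mul _)
    (Eventually.of_forall fun ω => hL (A ω))
  · exact Eventually.of_forall fun t =>
      ((integral_tail_of_indepFun hVmeas hA hindep hh t).1.const_mul _).aestronglyMeasurable
  · filter_upwards [eventually_gt_atTop 0] with t ht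
    refine Eventually.of_forall fun ω' => ?_
    rw [Real.norm_of_nonneg (mul_nonneg (Real.rpow_nonneg ht.le _) measureReal_nonneg), mul_assoc,
      ← Real.mul_rpow (by positivity) (norm_nonneg _)]
    refine rpow_mul_tail_le_of_le hα hB (by positivity) (fun ω => ?_) ht
    refine (le_abs_self _).trans ((hH _).trans ?_)
    have := mul_le_mul_of_nonneg_left (norm_mulVec_le_card_mul (A ω') (V ω)) hH0
    rw [Fintype.card_fin] at this
    linarith

theorem integrable_rpow_of_le_norm (hα : 0 < α) (hA : Measurable A)
    (hAint : Integrable (fun ω => ‖A ω‖ ^ α) P)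
    (hh : Continuous h) (hom : ∀ (c : ℝ) x, 0 < c → h (c • x) = c * h x) (hh0 : ∀ x, 0 ≤ h x)
    (v : Fin d → ℝ) : Integrable (fun ω => h (Matrix.of (A ω) *ᵥ v) ^ α) P := by
  obtain ⟨H, hH0, hH⟩ := exists_abs_le_mul_norm hh hom
  refine (hAint.const_mul ((H * (d * ‖v‖)) ^ α)).mono' ?_ (Eventually.of_forall fun ω => ?_)
  · have h1 : Continuous fun a : Fin q → Fin d → ℝ => h (Matrix.of a *ᵥ v) :=
      hh.comp (continuous_mulVec_of.comp (by fun_prop : Continuous fun a => (v, a)))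
    exact ((h1.measurable.comp hA).pow_const α).aestronglyMeasurable
  · rw [Real.norm_of_nonneg (Real.rpow_nonneg (hh0 _) _),
      ← Real.mul_rpow (by positivity) (norm_nonneg _)]
    refine Real.rpow_le_rpow (hh0 _) ?_ hα.le
    have := mul_le_mul_of_nonneg_left (norm_mulVec_le_card_mul (A ω) v) hH0
    rw [Fintype.card_fin] at this
    linarith [le_abs_self (h (Matrix.of (A ω) *ᵥ v)), hH (Matrix.of (A ω) *ᵥ v)]

/-- Moments of order `α + δ` of a random matrix give moments of order `α` of a dominated one. -/
theorem integrable_norm_rpow_of_seminorm [IsProbabilityMeasure P] {δ : ℝ} (hα : 0 < α) (hδ : 0 < δ) (hA : Measurable A)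
    {W : Ω → Fin q → Fin d → ℝ} (hAW : ∀ ω, ‖A ω‖ ≤ ‖W ω‖)
    (M : Seminorm ℝ (Matrix (Fin q) (Fin d) ℝ)) (hM : ∀ B, M B = 0 → B = 0)
    (hWint : Integrable (fun ω => M (Matrix.of (W ω)) ^ (α + δ)) P) :
    Integrable (fun ω => ‖A ω‖ ^ α) P := by
  obtain ⟨c, hc, hcM⟩ := exists_pos_mul_norm_le
    (M.comp (Matrix.ofLinearEquiv ℝ :
      (Fin q → Fin d → ℝ) ≃ₗ[ℝ] Matrix (Fin q) (Fin d) ℝ).toLinearMap) fun x hx => by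
      exact (Matrix.ofLinearEquiv ℝ).map_eq_zero_iff.1 (hM _ hx)
  refine (((integrable_const (1 : ℝ)).add hWint).const_mul ((c⁻¹) ^ α)).mono'
    ((hA.norm.pow_const α).aestronglyMeasurable) (Eventually.of_forall fun ω => ?_)
  have hm0 : 0 ≤ M (Matrix.of (W ω)) := apply_nonneg M _
  have h1 : ‖A ω‖ ≤ c⁻¹ * M (Matrix.of (W ω)) := by
    rw [le_inv_mul_iff₀ hc]
    exact (mul_le_mul_of_nonneg_left (hAW ω) hc.le).trans (hcM (W ω))
  rw [Real.norm_of_nonneg (Real.rpow_nonneg (norm_nonneg _) _)]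
  refine (Real.rpow_le_rpow (norm_nonneg _) h1 hα.le).trans ?_
  rw [Real.mul_rpow (inv_pos.2 hc).le hm0]
  refine mul_le_mul_of_nonneg_left ?_ (Real.rpow_nonneg (inv_pos.2 hc).le _)
  -- The first summand covers values of `M` up to 1, the second those above 1.
  show M (Matrix.of (W ω)) ^ α ≤ 1 + M (Matrix.of (W ω)) ^ (α + δ)
  rcases le_total (M (Matrix.of (W ω))) 1 with h | h
  · have := Real.rpow_le_one hm0 h hα.le
    linarith [Real.rpow_nonneg hm0 (α + δ)]
  · have := Real.rpow_le_rpow_of_exponent_le h (by linarith : α ≤ α + δ)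
    linarith

end Mixture

/-! ### Extending the aggregation function off the orthant -/

section Aggregation

variable {q : ℕ} {h : (Fin q → ℝ) → ℝ}

/-- Composing with the positive part gives a globally continuous function that agrees with `h` on
the orthant, so earlier results stated on the whole space apply. -/
theorem IsAggregation.continuous_comp_sup (hh : IsAggregation h) :
    Continuous fun x => h (x ⊔ 0) :=
  hh.continuousOn.comp_continuous
    (continuous_pi fun i => (continuous_apply i).max continuous_const) fun x => by
      show 0 ≤ x ⊔ 0
      exact le_sup_right

theorem IsAggregation.comp_sup_smul (hh : IsAggregation h) (c : ℝ) (x : Fin q → ℝ) (hc : 0 < c) :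
    h ((c • x) ⊔ 0) = c * h (x ⊔ 0) := by
  rw [← hh.homogeneous c _ hc le_sup_right]
  congr 1
  ext i
  simp [mul_max_of_nonneg _ _ hc.le]

end Aggregation

/-! ### The weighted adjacency matrix -/

section WeightedAdj

variable {Ω : Type*} {q d : ℕ}
  {W : Ω → Matrix (Fin q) (Fin d) ℝ} {E : Ω → Fin q → Fin d → Prop}

theorem weightedAdj_nonneg (hW : ∀ ω i j, 0 ≤ W ω i j) (ω : Ω) (i : Fin q) (j : Fin d) :
    0 ≤ weightedAdj W E ω i j := by
  simp only [weightedAdj, Matrix.of_apply]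
  split_ifs
  exacts [hW ω i j, le_rfl]

theorem measurable_weightedAdj [MeasurableSpace Ω] (hW : ∀ i j, Measurable fun ω => W ω i j)
    (hE : ∀ i j, MeasurableSet {ω | E ω i j}) :
    Measurable fun ω (i : Fin q) (j : Fin d) => weightedAdj W E ω i j := by
  refine measurable_pi_lambda _ fun i => measurable_pi_lambda _ fun j => ?_
  simp only [weightedAdj, Matrix.of_apply]
  exact Measurable.ite (hE i j) (hW i j) measurable_const

theorem norm_weightedAdj_le (ω : Ω) :
    ‖(fun i j => weightedAdj W E ω i j : Fin q → Fin d → ℝ)‖ ≤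
      ‖(fun i j => W ω i j : Fin q → Fin d → ℝ)‖ := by
  rw [pi_norm_le_iff_of_nonneg (norm_nonneg _)]
  intro i
  rw [pi_norm_le_iff_of_nonneg (norm_nonneg _)]
  intro j
  have h1 : ‖W ω i j‖ ≤ ‖(fun i j => W ω i j : Fin q → Fin d → ℝ)‖ :=
    (norm_le_pi_norm (fun j => W ω i j) j).trans
      (norm_le_pi_norm (fun i j => W ω i j : Fin q → Fin d → ℝ) i)
  simp only [weightedAdj, Matrix.of_apply]
  split_ifs
  · exact h1
  · rw [norm_zero]
    exact norm_nonneg _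

end WeightedAdj

/-! ### Nonnegative matrices and positivity of the constants -/

theorem mulVec_nonneg_of_nonneg {q d : ℕ} {B : Matrix (Fin q) (Fin d) ℝ} (hB : ∀ i j, 0 ≤ B i j)
    {v : Fin d → ℝ} (hv : ∀ j, 0 ≤ v j) : 0 ≤ B *ᵥ v := fun i =>
  show 0 ≤ ∑ j, B i j * v j from Finset.sum_nonneg fun j _ => mul_nonneg (hB i j) (hv j)

theorem eq_zero_of_mulVec_eq_zero {q d : ℕ} {B : Matrix (Fin q) (Fin d) ℝ} (hB : ∀ i j, 0 ≤ B i j)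
    {v : Fin d → ℝ} (hv : ∀ j, 0 < v j) (h : B *ᵥ v = 0) : B = 0 := by
  ext i j
  have h1 : ∑ j, B i j * v j = 0 := congrFun h i
  have h2 := (Finset.sum_eq_zero_iff_of_nonneg fun j _ => mul_nonneg (hB i j) (hv j).le).1 h1 j
    (Finset.mem_univ j)
  exact (mul_eq_zero.1 h2).resolve_right (hv j).ne'

/-- A vanishing moment of a definite aggregation function forces its argument to vanish. -/
theorem IsAggregation.ae_eq_zero_of_integral_eq_zero {Ω : Type*} [MeasurableSpace Ω]
    {P : Measure Ω} {q : ℕ} {h : (Fin q → ℝ) → ℝ} (hh : IsAggregation h) {α : ℝ} (hα : 0 < α)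
    (hne : ∀ x, 0 ≤ x → x ≠ 0 → h x ≠ 0) {Y : Ω → Fin q → ℝ} (hY : ∀ ω, 0 ≤ Y ω)
    (hint : Integrable (fun ω => h (Y ω) ^ α) P) (h0 : ∫ ω, h (Y ω) ^ α ∂P = 0) :
    ∀ᵐ ω ∂P, Y ω = 0 := by
  have h1 := (integral_eq_zero_iff_of_nonneg
    (fun ω => Real.rpow_nonneg (hh.nonneg _ (hY ω)) _) hint).1 h0
  filter_upwards [h1] with ω hω
  by_contra hcon
  exact hne _ (hY ω) hcon ((Real.rpow_eq_zero (hh.nonneg _ (hY ω)) hα.ne').1 hω)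

end BipartiteRisk

/-! ### The main theorem -/

open BipartiteRisk in
theorem proposition3p2 {Ω : Type*} [MeasurableSpace Ω] (P : Measure Ω) [IsProbabilityMeasure P]
    {q d : ℕ} (α δ : ℝ) (hα : 0 < α) (hδ : 0 < δ)
    -- the losses: nonnegative, with Pareto tails, multivariate regularly varying
    (V : Ω → Fin d → ℝ) (hVmeas : Measurable V) (hVnonneg : ∀ ω j, 0 ≤ V ω j)
    (K : Fin d → ℝ) (hK : ∀ j, 0 < K j)
    (hPareto : ∀ j, (fun t : ℝ => P.real {ω | t < V ω j}) ~[atTop] fun t : ℝ => K j * t ^ (-α))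
    (N : Seminorm ℝ (Fin d → ℝ)) (hN : ∀ x, N x = 0 → x = 0) (hNunit : ∀ j, N (Pi.single j 1) = 1)
    (μ : Measure (BipartiteRisk.PuncturedOrthant d))
    (hμ : BipartiteRisk.IsIntensityMeasure P N V μ)
    -- the random weights and the random bipartite graph, independent of the losses
    (W : Ω → Matrix (Fin q) (Fin d) ℝ) (hWmeas : ∀ i j, Measurable fun ω => W ω i j)
    (hWnonneg : ∀ ω i j, 0 ≤ W ω i j)
    (M : Seminorm ℝ (Matrix (Fin q) (Fin d) ℝ)) (hM : ∀ B, M B = 0 → B = 0)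
    (hWint : Integrable (fun ω => M (W ω) ^ (α + δ)) P)
    (E : Ω → Fin q → Fin d → Prop) (hE : ∀ i j, MeasurableSet {ω | E ω i j})
    (A : Ω → Matrix (Fin q) (Fin d) ℝ) (hA : A = BipartiteRisk.weightedAdj W E)
    (hindep : IndepFun V (fun ω (i : Fin q) (j : Fin d) => A ω i j) P)
    -- the aggregation function
    (h : (Fin q → ℝ) → ℝ) (hh : BipartiteRisk.IsAggregation h) :
    (BipartiteRisk.AsympIndependent μ →
      (∀ j, Integrable (fun ω => h (A ω *ᵥ Pi.single j 1) ^ α) P) ∧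
      BipartiteRisk.HasTail P (fun ω => h (A ω *ᵥ V ω)) (BipartiteRisk.constInd P A K α h) α ∧
      ((∀ x, 0 ≤ x → x ≠ 0 → h x ≠ 0) → ¬ (∀ᵐ ω ∂P, A ω = 0) →
        0 < BipartiteRisk.constInd P A K α h)) ∧
    (BipartiteRisk.AsympFullyDependent μ K α →
      Integrable (fun ω =>
        h ((A ω * Matrix.diagonal (fun j => K j ^ (1 / α))) *ᵥ (1 : Fin d → ℝ)) ^ α) P ∧
      BipartiteRisk.HasTail P (fun ω => h (A ω *ᵥ V ω)) (BipartiteRisk.constDep P A K α h) α ∧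
      ((∀ x, 0 ≤ x → x ≠ 0 → h x ≠ 0) → ¬ (∀ᵐ ω ∂P, A ω = 0) →
        0 < BipartiteRisk.constDep P A K α h)) := by
  classical
  have hV := fun j => tendsto_rpow_mul_tail_of_isEquivalent (hPareto j)
  have hA0 : ∀ ω i j, 0 ≤ A ω i j := fun ω => hA ▸ weightedAdj_nonneg hWnonneg ω
  have hAmeas : Measurable fun ω (i : Fin q) (j : Fin d) => A ω i j :=
    hA ▸ measurable_weightedAdj hWmeas hE
  have hAint : Integrable (fun ω => ‖(fun i j => A ω i j : Fin q → Fin d → ℝ)‖ ^ α) P :=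
    integrable_norm_rpow_of_seminorm (W := fun ω i j => W ω i j) hα hδ hAmeas
      (fun ω => by subst hA; exact norm_weightedAdj_le ω) M hM hWint
  set g : (Fin q → ℝ) → ℝ := fun x => h (x ⊔ 0) with hg
  have hgc : Continuous g := hh.continuous_comp_sup
  have hgom : ∀ (c : ℝ) x, 0 < c → g (c • x) = c * g x := hh.comp_sup_smul
  have hg0 : ∀ x, 0 ≤ g x := fun x => hh.nonneg _ le_sup_right
  have hgh : ∀ x, 0 ≤ x → g x = h x := fun x hx => by rw [hg]; simp only [sup_eq_left.2 hx]
  have hgA : ∀ ω v, (∀ j, 0 ≤ v j) → g (A ω *ᵥ v) = h (A ω *ᵥ v) := fun ω v hv =>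
    hgh _ (mulVec_nonneg_of_nonneg (hA0 ω) hv)
  have hintA : ∀ v : Fin d → ℝ, (∀ j, 0 ≤ v j) → Integrable (fun ω => h (A ω *ᵥ v) ^ α) P :=
    fun v hv => (integrable_rpow_of_le_norm hα hAmeas hAint hgc hgom hg0 v).congr
      (Eventually.of_forall fun ω => congrArg (· ^ α) (hgA ω v hv))
  have hgac : ∀ a : Fin q → Fin d → ℝ, Continuous fun x => g (Matrix.of a *ᵥ x) := fun a =>
    hgc.comp (continuous_mulVec_of.comp (by fun_prop : Continuous fun x => (x, a)))
  have hgaom : ∀ (a : Fin q → Fin d → ℝ) (c : ℝ) (x : Fin d → ℝ), 0 < c →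
      g (Matrix.of a *ᵥ (c • x)) = c * g (Matrix.of a *ᵥ x) := fun a c x hc => by
    rw [Matrix.mulVec_smul, hgom _ _ hc]
  -- Both dependence cases reduce to this: supply the tail constant `L a` of each frozen matrix and
  -- average it.
  have htail : ∀ L : (Fin q → Fin d → ℝ) → ℝ,
      (∀ a, Tendsto (fun t : ℝ => t ^ α * P.real {ω | t < g (Matrix.of a *ᵥ V ω)})
        atTop (𝓝 (L a))) →
      HasTail P (fun ω => h (A ω *ᵥ V ω)) (∫ ω, L (fun i j => A ω i j) ∂P) α := fun L hL => by
    have h1 := tendsto_tail_mulVec_of_indepFun hα hVmeas hVnonneg hV hAmeas hindep hAint hgc hgom hL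
    refine hasTail_of_tendsto (h1.congr fun t => ?_)
    have h2 : ∀ ω, g (Matrix.of (fun i j => A ω i j) *ᵥ V ω) = h (A ω *ᵥ V ω) := fun ω =>
      hgA ω _ (hVnonneg ω)
    simp only [h2]
  have hsingle : ∀ j k, 0 ≤ (Pi.single j 1 : Fin d → ℝ) k := fun j k => by
    rw [Pi.single_apply]
    split_ifs <;> norm_num
  refine ⟨fun hind => ⟨fun j => hintA _ (hsingle j), ?_, fun hne hAne => ?_⟩, fun hdep => ?_⟩
  · have h1 := htail (fun a => ∑ j, K j * g (Matrix.of a *ᵥ Pi.single j 1) ^ α) fun a =>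
      hind.tendsto_tail (g := fun x => g (Matrix.of a *ᵥ x)) hα hVmeas hVnonneg hK hV hN hNunit hμ
        (hgac a) (hgaom a) fun x => hg0 _
    convert h1 using 1
    have h2 : ∀ ω j, g (Matrix.of (fun i j => A ω i j) *ᵥ Pi.single j 1) =
      h (A ω *ᵥ Pi.single j 1) := fun ω j => hgA ω _ (hsingle j)
    simp only [h2]
    rw [integral_finsetSum _ fun j _ => (hintA _ (hsingle j)).const_mul _]
    simp only [integral_const_mul, constInd]
  · have hterm : ∀ j ∈ Finset.univ, 0 ≤ K j * ∫ ω, h (A ω *ᵥ Pi.single j 1) ^ α ∂P := fun j _ =>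
      mul_nonneg (hK j).le (integral_nonneg fun ω => Real.rpow_nonneg
        (hh.nonneg _ (mulVec_nonneg_of_nonneg (hA0 ω) (hsingle j))) _)
    rw [constInd]
    refine lt_of_le_of_ne (Finset.sum_nonneg hterm) fun h0 => hAne ?_
    have h1 := (Finset.sum_eq_zero_iff_of_nonneg hterm).1 h0.symm
    -- Since `K j > 0`, a vanishing constant forces each moment to vanish, hence each column of `A`
    -- to be zero almost surely.
    have h2 : ∀ j, ∀ᵐ ω ∂P, A ω *ᵥ Pi.single j 1 = 0 := fun j =>
      hh.ae_eq_zero_of_integral_eq_zero hα hne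
        (fun ω => mulVec_nonneg_of_nonneg (hA0 ω) (hsingle j)) (hintA _ (hsingle j))
        ((mul_eq_zero.1 (h1 j (Finset.mem_univ j))).resolve_left (hK j).ne')
    filter_upwards [ae_all_iff.2 h2] with ω hω
    ext i j
    have := congrFun (hω j) i
    rwa [Matrix.mulVec_single_one] at this
  · have hw0 : ∀ j, 0 < K j ^ (1 / α) := fun j => Real.rpow_pos_of_pos (hK j) _
    have hdiag : ∀ ω, (A ω * Matrix.diagonal (fun j => K j ^ (1 / α))) *ᵥ (1 : Fin d → ℝ) =
        A ω *ᵥ fun j => K j ^ (1 / α) := fun ω => by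
      rw [← Matrix.mulVec_mulVec]
      congr 1
      ext j
      simp [Matrix.mulVec_diagonal]
    have hint := hintA _ fun j => (hw0 j).le
    simp only [constDep, hdiag]
    refine ⟨hint, ?_, fun hne hAne => ?_⟩
    · have h1 := htail (fun a => g (Matrix.of a *ᵥ fun j => K j ^ (1 / α)) ^ α) fun a =>
        hdep.tendsto_tail (g := fun x => g (Matrix.of a *ᵥ x)) hα hVmeas hVnonneg hK hV hN hNunit hμ
          (hgac a) (hgaom a) fun x => hg0 _
      convert h1 using 4 with ω
      exact (hgA ω _ fun j => (hw0 j).le).symm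
    · have hY : ∀ ω, 0 ≤ A ω *ᵥ fun j => K j ^ (1 / α) := fun ω =>
        mulVec_nonneg_of_nonneg (hA0 ω) fun j => (hw0 j).le
      refine lt_of_le_of_ne (integral_nonneg fun ω => Real.rpow_nonneg (hh.nonneg _ (hY ω)) _)
        fun h0 => hAne ?_
      filter_upwards [hh.ae_eq_zero_of_integral_eq_zero hα hne hY hint h0.symm] with ω hω
      exact eq_zero_of_mulVec_eq_zero (hA0 ω) hw0 hω
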